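/- Represent a permutation $\sigma$ of $\{1,\dots,n\}$ by its diagram: bottom points $1,\dots,n$, top points $1,\dots,n$, and an edge from bottom $i$ to top $\sigma(i)$ for each $i$. *Cycle invariant.* Split every point into a black endpoint (left) and a white endpoint (right), replace each edge $(i,\sigma(i))$ by two strands joining black $i$ to white $\sigma(i)$ and white $i$ to black $\sigma(i)$, and on each line join the white endpoint of the $k$-th point to the black endpoint of the $(k+1)$-st point by an arc ($1\le k<n$). Finally join the white endpoint of the last top point to the black endpoint of the first bottom point, and the white endpoint of the last bottom point to the black endpoint of the first top point; these two connections are not counted as arcs. The result is a union of closed cycles; the length of a cycle is its number of top arcs, and $\lambda(\sigma)$ is the multiset of the lengths. *Sign.* For a set $I$ of edges let $\chi(I)$ be the number of pairs of non-crossing edges in $I$ (pairs $i<j$ with $\sigma(i)<\sigma(j)$), and let $s(\sigma)\in\{-1,0,1\}$ be the sign of $\overline{A}(\sigma)=\sum_{I}(-1)^{|I|+\chi(I)}$, the sum being over all sets $I$ of edges. The invariant of $\sigma$ is the pair $(\lambda(\sigma),s(\sigma))$. *Statement.* Let $\sigma$ be a permutation with invariant $(\lambda,s)$ and let $\tau$,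 with invariant $(\lambda',s')$, be the permutation obtained from $\sigma$ by deleting one (gray) edge $e=(i,\sigma(i))$ and renumbering the remaining points in increasing order. Suppose that $\lambda'=\lambda\setminus\{\ell,\ell'\}\cup\{\ell+\ell'-1\}$ for some $\ell,\ell'$ with $\{\ell,\ell'\}\subseteq\lambda$ (as multisets). Then: 1. if $\lambda'$ contains an even element, then $s'=0$; 2. if $\lambda'$ contains no even element, then $s'=s$, except possibly when $s=0$ and $\ell,\ell'$ are both even. -/

import Mathlib

/-!
A permutation `σ` of `{1, …, n}` is drawn as a diagram with `n` points on a bottom line, `n` points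
on a top line, and one edge from the bottom point `i` to the top point `σ i` for every `i`.
Here positions are the elements of `Fin n`, so they are counted from `0`.
-/

namespace PermDiagram

/-- The boundary points of the diagram of a permutation of size `n`: `inl i` is the `i`-th point of
the bottom line, `inr j` is the `j`-th point of the top line. -/
abbrev Point (n : ℕ) : Type := Fin n ⊕ Fin n

/-- Every boundary point `p` is split into a black endpoint (on the left) and a white endpoint (on
the right), and every edge `(i, σ i)` is replaced by two crossing strands, one joining black `i` to
white `σ i` and one joining white `i` to black `σ i`.
`strand σ p` is the point whose white endpoint is joined to the black endpoint of `p`. -/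
def strand {n : ℕ} (σ : Equiv.Perm (Fin n)) : Equiv.Perm (Point n) where
  toFun
    | Sum.inl i => Sum.inr (σ i)
    | Sum.inr j => Sum.inl (σ.symm j)
  invFun
    | Sum.inl i => Sum.inr (σ i)
    | Sum.inr j => Sum.inl (σ.symm j)
  left_inv := by rintro (i | j) <;> simp
  right_inv := by rintro (i | j) <;> simp

/-- On both lines, the white endpoint of each point is joined by an arc to the black endpoint of
the next point. The four remaining extremal endpoints are joined by two marks: the white endpoint of
the last top point with the black endpoint of the first bottom point, and the white endpoint of the
last bottom point with the black endpoint of the first top point.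
`arc n p` is the point whose black endpoint is joined in this way to the white endpoint of `p`. -/
def arc (n : ℕ) : Equiv.Perm (Point n) where
  toFun
    | Sum.inl i => if h : i.val + 1 < n then Sum.inl ⟨i.val + 1, h⟩ else Sum.inr ⟨0, i.pos⟩
    | Sum.inr j => if h : j.val + 1 < n then Sum.inr ⟨j.val + 1, h⟩ else Sum.inl ⟨0, j.pos⟩
  invFun
    | Sum.inl i => if i.val = 0 then Sum.inr ⟨n - 1, by have := i.isLt; omega⟩
        else Sum.inl ⟨i.val - 1, by have := i.isLt; omega⟩
    | Sum.inr j => if j.val = 0 then Sum.inl ⟨n - 1, by have := j.isLt; omega⟩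
        else Sum.inr ⟨j.val - 1, by have := j.isLt; omega⟩
  left_inv := by
    rintro (⟨i, hi⟩ | ⟨i, hi⟩) <;> by_cases h : i + 1 < n <;> simp [h] <;> omega
  right_inv := by
    rintro (⟨i, hi⟩ | ⟨i, hi⟩) <;> by_cases h : i = 0
    · subst h
      simp [show ¬ (n - 1 + 1 < n) by omega]
    · simp [h, show i - 1 + 1 = i by omega, hi]
    · subst h
      simp [show ¬ (n - 1 + 1 < n) by omega]
    · simp [h, show i - 1 + 1 = i by omega, hi]

/-- Following the strand that leaves a black endpoint, and then the arc or mark at the white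
endpoint that is reached, leads to the next black endpoint. The orbits of this permutation are the
cycles of the diagram. -/
def walk {n : ℕ} (σ : Equiv.Perm (Fin n)) : Equiv.Perm (Point n) :=
  (strand σ).trans (arc n)

/-- The set of cycles of the diagram of `σ`, each given as a set of black endpoints. -/
abbrev Cycle {n : ℕ} (σ : Equiv.Perm (Fin n)) : Type :=
  Quotient (Equiv.Perm.SameCycle.setoid (walk σ))

instance {n : ℕ} (σ : Equiv.Perm (Fin n)) : DecidableEq (Cycle σ) :=
  @Quotient.decidableEq _ (Equiv.Perm.SameCycle.setoid (walk σ))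
    (inferInstanceAs (DecidableRel (Equiv.Perm.SameCycle (walk σ))))

instance {n : ℕ} (σ : Equiv.Perm (Fin n)) : Fintype (Cycle σ) :=
  @Quotient.fintype _ _ (Equiv.Perm.SameCycle.setoid (walk σ))
    (inferInstanceAs (DecidableRel (Equiv.Perm.SameCycle (walk σ))))

/-- The length of a cycle is the number of top arcs in it; marks are not counted. The top arc
between the positions `j - 1` and `j` is the one that ends in the black endpoint of the top point
`j`, so that top arcs correspond to the top points `j ≠ 0`. -/
def cycleLength {n : ℕ} (σ : Equiv.Perm (Fin n)) (c : Cycle σ) : ℕ :=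
  (Finset.univ.filter fun j : Fin n =>
    0 < j.val ∧ Quotient.mk (Equiv.Perm.SameCycle.setoid (walk σ)) (Sum.inr j) = c).card

/-- The cycle invariant `λ` of `σ`: the multiset of the lengths of the cycles. -/
def cycleInvariant {n : ℕ} (σ : Equiv.Perm (Fin n)) : Multiset ℕ :=
  (Finset.univ : Finset (Cycle σ)).val.map (cycleLength σ)

/-- The number of pairs of non-crossing edges among the edges `(i, σ i)` with `i ∈ I`. -/
def nonCrossing {n : ℕ} (σ : Equiv.Perm (Fin n)) (I : Finset (Fin n)) : ℕ :=
  ((I ×ˢ I).filter fun p => p.1 < p.2 ∧ σ p.1 < σ p.2).card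

/-- The Arf function of `σ`: the sum of `(-1) ^ (|I| + χ(I))` over all sets `I` of edges, where
`χ(I)` is the number of non-crossing pairs in `I`. -/
def arf {n : ℕ} (σ : Equiv.Perm (Fin n)) : ℤ :=
  ∑ I : Finset (Fin n), (-1) ^ (I.card + nonCrossing σ I)

/-- The sign invariant `s` of `σ`, one of `-1`, `0`, `1`. -/
def sign {n : ℕ} (σ : Equiv.Perm (Fin n)) : ℤ := Int.sign (arf σ)

/-- The reduction of `σ` when the edge `(i, σ i)` is the only gray edge: this edge is deleted and
the remaining bottom points and top points are renumbered in increasing order. -/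
def reduction {n : ℕ} (σ : Equiv.Perm (Fin (n + 1))) (i : Fin (n + 1)) : Equiv.Perm (Fin n) :=
  ((finSuccAboveEquiv i).trans
    (σ.subtypeEquiv fun _ => not_congr σ.injective.eq_iff.symm)).trans
      (finSuccAboveEquiv (σ i)).symm

theorem succAbove_reduction {n : ℕ} (σ : Equiv.Perm (Fin (n + 1))) (i : Fin (n + 1)) (k : Fin n) :
    (σ i).succAbove (reduction σ i k) = σ (i.succAbove k) := by
  have h := (finSuccAboveEquiv (σ i)).apply_symm_apply
    (σ.subtypeEquiv (fun _ => not_congr σ.injective.eq_iff.symm) (finSuccAboveEquiv i k))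
  exact congrArg Subtype.val h

end PermDiagram

/-! `arf σ` is the Gauss sum of a quadratic form `quad σ` over `ZMod 2`, and the cycles of the
diagram supply vectors in the radical of its polar form. A function constant on cycles gives the
radical vector `edgeVector`, by telescoping along the two lines. For a cycle of length `ℓ` the form
takes the value `ℓ + 1` there (`quad_edgeVector_cycleIndicator`). To see this, compare the sign of a
single cycle with its number of inversions when the bottom line is read before the top line.

Translation by a radical vector shifts the form by a constant. A cycle of even length gives the
constant 1, so the Gauss sum is its own negative and vanishes. A cycle of odd length through exactly
one end of edge `i` gives the constant 0 and exchanges the sets containing `i` with those avoiding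
it, so `arf σ = 2 * arf (reduction σ i)`.

If all lengths in `λ'` are odd, then `ℓ` and `ℓ'` have the same parity. Both even is exactly the
exceptional case, since then `s = 0`; otherwise every cycle of `σ` is odd. The two ends of edge `i`
lie on different cycles, since otherwise its deletion could not lower the number of cycles, whereas
`λ'` has one element fewer than `λ`. -/

namespace PermDiagram

open Finset

/-! ### The Arf function as a Gauss sum, and translation by radical vectors. -/

/-- The sign character of `ZMod 2`. -/
def signChar (a : ZMod 2) : ℤ := if a = 0 then 1 else -1

theorem signChar_add (a b : ZMod 2) : signChar (a + b) = signChar a * signChar b := by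
  revert a b; decide

theorem signChar_natCast (k : ℕ) : signChar (k : ZMod 2) = (-1) ^ k := by
  induction k with
  | zero => simp [signChar]
  | succ k ih => rw [Nat.cast_succ, signChar_add, ih, pow_succ]; rfl

theorem sq_zmod_two (a : ZMod 2) : a * a = a := by revert a; decide

theorem eq_one_of_ne_zero {a : ZMod 2} (h : a ≠ 0) : a = 1 := by revert a; decide

theorem add_one_eq_zero_iff (a : ZMod 2) : a + 1 = 0 ↔ ¬ a = 0 := by revert a; decide

theorem two_mul_zmod_two (a : ZMod 2) : a + a = 0 := by revert a; decide

/-- The indicator of the ordered non-crossing pairs of edges. -/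
def parallel {n : ℕ} (σ : Equiv.Perm (Fin n)) (j k : Fin n) : ZMod 2 :=
  if j < k ∧ σ j < σ k then 1 else 0

/-- The quadratic form over `ZMod 2` whose Gauss sum is the Arf function. -/
def quad {n : ℕ} (σ : Equiv.Perm (Fin n)) (x : Fin n → ZMod 2) : ZMod 2 :=
  ∑ j, x j + ∑ j, ∑ k, parallel σ j k * (x j * x k)

/-- The vectors in the radical of the bilinear form attached to `quad σ`. -/
def IsRadical {n : ℕ} (σ : Equiv.Perm (Fin n)) (v : Fin n → ZMod 2) : Prop :=
  ∀ j, ∑ k, (parallel σ j k + parallel σ k j) * v k = 0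

theorem IsRadical.sum_parallel {n : ℕ} {σ : Equiv.Perm (Fin n)} {v : Fin n → ZMod 2}
    (hv : IsRadical σ v) (x : Fin n → ZMod 2) :
    ∑ j, ∑ k, parallel σ j k * (x j * v k + v j * x k) = 0 := by
  have h : ∑ j, ∑ k, parallel σ j k * (v j * x k) = ∑ j, ∑ k, parallel σ k j * (x j * v k) := by
    rw [sum_comm]
    exact sum_congr rfl fun j _ => sum_congr rfl fun k _ => by ring
  simp only [mul_add, sum_add_distrib]
  rw [h, ← sum_add_distrib]
  refine sum_eq_zero fun j _ => ?_
  rw [← sum_add_distrib]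
  have := congrArg (x j * ·) (hv j)
  simp only [mul_sum, mul_zero] at this
  rw [← this]
  exact sum_congr rfl fun k _ => by ring

theorem IsRadical.quad_add {n : ℕ} {σ : Equiv.Perm (Fin n)} {v : Fin n → ZMod 2}
    (hv : IsRadical σ v) (x : Fin n → ZMod 2) : quad σ (x + v) = quad σ x + quad σ v := by
  have h : ∑ j, ∑ k, parallel σ j k * ((x + v) j * (x + v) k) =
      ∑ j, ∑ k, parallel σ j k * (x j * x k) + ∑ j, ∑ k, parallel σ j k * (v j * v k) +
      ∑ j, ∑ k, parallel σ j k * (x j * v k + v j * x k) := by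
    simp only [← sum_add_distrib, Pi.add_apply]
    exact sum_congr rfl fun j _ => sum_congr rfl fun k _ => by ring
  rw [quad, h, hv.sum_parallel]
  simp only [quad, Pi.add_apply, sum_add_distrib]
  ring

/-- Sets of edges as vectors over `ZMod 2`. -/
def indicatorEquiv (n : ℕ) : Finset (Fin n) ≃ (Fin n → ZMod 2) where
  toFun I j := if j ∈ I then 1 else 0
  invFun x := univ.filter fun j => x j = 1
  left_inv I := by ext j; simp
  right_inv x := by
    funext j
    by_cases h : x j = 0
    · simp [h]
    · simp [eq_one_of_ne_zero h]

theorem arf_eq_sum_signChar {n : ℕ} (σ : Equiv.Perm (Fin n)) :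
    arf σ = ∑ x : Fin n → ZMod 2, signChar (quad σ x) := by
  refine Fintype.sum_equiv (indicatorEquiv n) _ _ fun I => ?_
  rw [← signChar_natCast]
  congr 1
  push_cast
  congr 1
  · simp [indicatorEquiv]
  · rw [nonCrossing, card_filter, sum_product, Nat.cast_sum]
    simp only [indicatorEquiv, Equiv.coe_fn_mk, parallel]
    simp only [mul_ite, mul_one, mul_zero]
    rw [← sum_filter_add_sum_filter_not univ (· ∈ I) (fun j => ∑ _, _)]
    simp only [Nat.cast_sum]
    have h : ∀ j ∈ univ.filter (fun j => j ∉ I), (∑ k : Fin n, if k ∈ I then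
        if j ∈ I then if j < k ∧ σ j < σ k then (1 : ZMod 2) else 0 else 0 else 0) = 0 := by
      intro j hj
      simp only [mem_filter] at hj
      simp [hj.2]
    rw [sum_congr rfl h]
    simp only [sum_const_zero, add_zero, filter_mem_eq_inter, univ_inter]
    refine sum_congr rfl fun j hj => ?_
    simp [hj, sum_ite_mem]

/-- Translation by `v` permutes the terms of the Gauss sum and negates each of them. -/
theorem arf_eq_zero_of_isRadical {n : ℕ} {σ : Equiv.Perm (Fin n)} {v : Fin n → ZMod 2}
    (hv : IsRadical σ v) (hq : quad σ v = 1) : arf σ = 0 := by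
  have h : arf σ = -arf σ := by
    conv_lhs => rw [arf_eq_sum_signChar, ← Equiv.sum_comp (Equiv.addRight v)]
    rw [arf_eq_sum_signChar, ← sum_neg_distrib]
    refine sum_congr rfl fun x _ => ?_
    rw [Equiv.coe_addRight, hv.quad_add, signChar_add, hq]
    simp [signChar]
  omega

theorem parallel_succAbove {n : ℕ} (σ : Equiv.Perm (Fin (n + 1))) (i : Fin (n + 1)) (j k : Fin n) :
    parallel σ (i.succAbove j) (i.succAbove k) = parallel (reduction σ i) j k := by
  rw [parallel, parallel, ← succAbove_reduction, ← succAbove_reduction]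
  simp only [Fin.succAbove_lt_succAbove_iff]

theorem quad_insertNth_zero {n : ℕ} (σ : Equiv.Perm (Fin (n + 1))) (i : Fin (n + 1))
    (y : Fin n → ZMod 2) :
    quad σ (i.insertNth (α := fun _ => ZMod 2) 0 y) = quad (reduction σ i) y := by
  simp [quad, Fin.sum_univ_succAbove _ i, parallel_succAbove]

/-- Translation by `v` preserves the form and flips coordinate `i`, so the halves `x i = 0` and `x i
≠ 0` contribute equally; the first is the Gauss sum of the reduction. -/
theorem arf_eq_two_mul_of_isRadical {n : ℕ} {σ : Equiv.Perm (Fin (n + 1))} {i : Fin (n + 1)}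
    {v : Fin (n + 1) → ZMod 2} (hv : IsRadical σ v) (hq : quad σ v = 0) (hi : v i = 1) :
    arf σ = 2 * arf (reduction σ i) := by
  have hsplit : ∑ x : Fin (n + 1) → ZMod 2, signChar (quad σ x) =
      ∑ x with x i = 0, signChar (quad σ x) + ∑ x with ¬ x i = 0, signChar (quad σ x) :=
    (sum_filter_add_sum_filter_not _ _ _).symm
  have hone : ∑ x with ¬ x i = 0, signChar (quad σ x) = ∑ x with x i = 0, signChar (quad σ x) := by
    refine sum_equiv (Equiv.addRight v) (fun x => ?_) fun x _ => ?_
    · simp only [mem_filter, mem_univ, true_and, Equiv.coe_addRight, Pi.add_apply, hi]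
      exact (add_one_eq_zero_iff (x i)).symm
    · rw [Equiv.coe_addRight, hv.quad_add, hq, add_zero]
  have hzero : ∑ x with x i = 0, signChar (quad σ x) =
      ∑ y, signChar (quad (reduction σ i) y) := by
    symm
    refine sum_bij' (fun y _ => i.insertNth (α := fun _ => ZMod 2) 0 y)
      (fun x _ => i.removeNth x) ?_ ?_ ?_ ?_ ?_
    · intro y _; simp
    · intro x _; simp
    · intro y _; simp
    · intro x hx
      simp only [mem_filter, mem_univ, true_and] at hx
      rw [← hx, Fin.insertNth_self_removeNth]
    · intro y _; rw [quad_insertNth_zero]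
  rw [arf_eq_sum_signChar, arf_eq_sum_signChar, hsplit, hone, hzero]
  ring

/-! ### Signs of permutations and inversions. -/

theorem exists_equiv_fin_of_injective {α : Type*} [Fintype α] {pos : α → ℕ}
    (hpos : Function.Injective pos) :
    ∃ e : α ≃ Fin (Fintype.card α), ∀ a b, e a < e b ↔ pos a < pos b := by
  have hcard : (univ.image pos).card = Fintype.card α := by
    rw [card_image_of_injective _ hpos, card_univ]
  let g : α ≃ (univ.image pos) := Equiv.ofBijective
    (fun a => ⟨pos a, mem_image_of_mem _ (mem_univ a)⟩)
    ⟨fun a b h => hpos (congrArg Subtype.val h), fun ⟨y, hy⟩ => by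
      obtain ⟨a, -, rfl⟩ := mem_image.1 hy
      exact ⟨a, rfl⟩⟩
  refine ⟨g.trans ((univ.image pos).orderIsoOfFin hcard).symm.toEquiv, fun a b => ?_⟩
  change ((univ.image pos).orderIsoOfFin hcard).symm (g a) <
    ((univ.image pos).orderIsoOfFin hcard).symm (g b) ↔ _
  rw [OrderIso.lt_iff_lt]
  rfl

/-- The sign of a permutation counts its inversions with respect to any total order. -/
theorem sign_eq_neg_one_pow_card_inversions {α : Type*} [Fintype α] [DecidableEq α] {pos : α → ℕ}
    (hpos : Function.Injective pos) (π : Equiv.Perm α) :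
    Equiv.Perm.sign π = (-1) ^ (univ.filter fun p : α × α =>
      pos p.1 < pos p.2 ∧ pos (π p.2) < pos (π p.1)).card := by
  obtain ⟨e, he⟩ := exists_equiv_fin_of_injective hpos
  rw [← Equiv.Perm.sign_permCongr e π, Equiv.Perm.sign_eq_prod_prod_Ioi, ← prod_const,
    prod_filter, Fintype.prod_prod_type, ← Equiv.prod_comp e]
  refine prod_congr rfl fun a _ => ?_
  rw [← filter_lt_eq_Ioi, prod_filter, ← Equiv.prod_comp e]
  refine prod_congr rfl fun b _ => ?_
  simp only [Equiv.permCongr_apply, Equiv.symm_apply_apply, he]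
  by_cases hab : pos a < pos b
  · have hne : pos (π a) ≠ pos (π b) := fun h => by
      rw [π.injective (hpos h)] at hab
      exact lt_irrefl _ hab
    rcases lt_or_gt_of_ne hne with h | h
    · simp [hab, h, h.not_gt]
    · simp [hab, h, h.not_gt]
  · simp [hab]

/-! ### Telescoping sums in characteristic 2. -/

theorem sum_range_ite_gt (u : ℕ → ZMod 2) (j N : ℕ) :
    ∑ k ∈ range N, (if j < k then u k + u (k + 1) else 0) =
      if j < N then u (j + 1) + u N else 0 := by
  induction N with
  | zero => simp
  | succ N ih =>
    rw [sum_range_succ, ih]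
    rcases lt_trichotomy j N with h | rfl | h
    · simp only [h, h.trans N.lt_succ_self, if_true]
      linear_combination two_mul_zmod_two (u N)
    · simp [two_mul_zmod_two]
    · simp [h.not_gt, show ¬ j < N + 1 by omega]

theorem sum_range_ite_lt (u : ℕ → ZMod 2) (j N : ℕ) (h : j ≤ N) :
    ∑ k ∈ range N, (if k < j then u k + u (k + 1) else 0) = u 0 + u j := by
  have aux : ∀ m, ∑ k ∈ range m, (u k + u (k + 1)) = u 0 + u m := fun m => by
    induction m with
    | zero => simp [two_mul_zmod_two]
    | succ m ih =>
      rw [sum_range_succ, ih]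
      linear_combination two_mul_zmod_two (u m)
  rw [← aux j, ← sum_filter]
  congr 1
  ext k
  simp only [mem_filter, mem_range]
  omega

/-! ### Radical vectors from functions constant on cycles. -/

section Walk

variable {m : ℕ} {σ : Equiv.Perm (Fin (m + 1))}

theorem arc_inl_last : arc (m + 1) (Sum.inl (Fin.last m)) = Sum.inr 0 := by
  simp [arc]

theorem arc_inr_last : arc (m + 1) (Sum.inr (Fin.last m)) = Sum.inl 0 := by
  simp [arc]

theorem arc_inl_castSucc (i : Fin m) : arc (m + 1) (Sum.inl i.castSucc) = Sum.inl i.succ := by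
  simp [arc, Fin.succ]

theorem arc_inr_castSucc (i : Fin m) : arc (m + 1) (Sum.inr i.castSucc) = Sum.inr i.succ := by
  simp [arc, Fin.succ]

theorem walk_apply (p : Point (m + 1)) : walk σ p = arc (m + 1) (strand σ p) := rfl

/-- The edge vector of a function on the points: the sum of its values at the ends of an edge. -/
def edgeVector (σ : Equiv.Perm (Fin (m + 1))) (f : Point (m + 1) → ZMod 2) :
    Fin (m + 1) → ZMod 2 := fun k => f (Sum.inl k) + f (Sum.inr (σ k))

theorem sum_gt_arc_inl (f : Point (m + 1) → ZMod 2) (j : Fin (m + 1)) :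
    ∑ k, (if j < k then f (Sum.inl k) + f (arc (m + 1) (Sum.inl k)) else 0) =
      f (arc (m + 1) (Sum.inl j)) + f (Sum.inr 0) := by
  -- The value past the end is taken at `Sum.inr 0`, where the mark leaving the last bottom point
  -- leads; thus `u (k + 1)` is the value at the `arc`-successor for every `k`.
  let u : ℕ → ZMod 2 := fun k => if h : k < m + 1 then f (Sum.inl ⟨k, h⟩) else f (Sum.inr 0)
  have hu : ∀ k : Fin (m + 1), u k = f (Sum.inl k) := fun k => by simp only [u, k.isLt, dif_pos]
  have hu' : ∀ k : Fin (m + 1), u (k + 1) = f (arc (m + 1) (Sum.inl k)) := fun k => by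
    by_cases h : (k : ℕ) < m <;> simp [u, arc, h]
  have key := sum_range_ite_gt u j (m + 1)
  rw [← Fin.sum_univ_eq_sum_range (fun k => if (j : ℕ) < k then u k + u (k + 1) else 0)] at key
  simp only [hu, hu', j.isLt, if_true, Fin.val_fin_lt] at key
  rw [key]
  simp [u]

theorem sum_lt_arc_inr (f : Point (m + 1) → ZMod 2) (j : Fin (m + 1)) :
    ∑ k, (if k < j then f (Sum.inr k) + f (arc (m + 1) (Sum.inr k)) else 0) =
      f (Sum.inr 0) + f (Sum.inr j) := by
  let u : ℕ → ZMod 2 := fun k => if h : k < m + 1 then f (Sum.inr ⟨k, h⟩) else f (Sum.inl 0)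
  have hu : ∀ k : Fin (m + 1), u k = f (Sum.inr k) := fun k => by simp only [u, k.isLt, dif_pos]
  have hu' : ∀ k : Fin (m + 1), u (k + 1) = f (arc (m + 1) (Sum.inr k)) := fun k => by
    by_cases h : (k : ℕ) < m <;> simp [u, arc, h]
  have key := sum_range_ite_lt u j (m + 1) j.isLt.le
  rw [← Fin.sum_univ_eq_sum_range (fun k => if k < (j : ℕ) then u k + u (k + 1) else 0)] at key
  simp only [hu, hu', Fin.val_fin_lt] at key
  rw [key]
  simp [u]

variable {f : Point (m + 1) → ZMod 2}

/-- The walk leads from `Sum.inr (σ k)` to the successor of `Sum.inl k`, so each entry of the edge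
vector is a difference of consecutive values on the bottom line, and the sum telescopes. -/
theorem sum_edgeVector_gt (hf : ∀ p, f (walk σ p) = f p) (j : Fin (m + 1)) :
    ∑ k, (if j < k then edgeVector σ f k else 0) = f (Sum.inr (σ j)) + f (Sum.inr 0) := by
  have h : ∀ k, f (arc (m + 1) (Sum.inl k)) = f (Sum.inr (σ k)) := fun k => by
    rw [← hf (Sum.inr (σ k))]
    simp [walk_apply, strand]
  rw [← h, ← sum_gt_arc_inl]
  simp only [h, edgeVector]

/-- The same telescoping on the top line, where the walk leads from `Sum.inl k` to the successor of
`Sum.inr (σ k)`. -/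
theorem sum_edgeVector_lt (hf : ∀ p, f (walk σ p) = f p) (j : Fin (m + 1)) :
    ∑ k, (if σ k < σ j then edgeVector σ f k else 0) = f (Sum.inr 0) + f (Sum.inr (σ j)) := by
  have h : ∀ k, f (arc (m + 1) (Sum.inr (σ k))) = f (Sum.inl k) := fun k => by
    rw [← hf (Sum.inl k)]
    simp [walk_apply, strand]
  rw [← sum_lt_arc_inr, ← Equiv.sum_comp σ fun k => if k < σ j then _ else _]
  simp only [h, edgeVector, add_comm]

theorem sum_edgeVector (hf : ∀ p, f (walk σ p) = f p) :
    ∑ k, edgeVector σ f k = f (Sum.inl 0) + f (Sum.inr 0) := by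
  have h := sum_edgeVector_gt hf 0
  have h2 : ∑ k, (if 0 < k then edgeVector σ f k else 0) + edgeVector σ f 0 =
      ∑ k, edgeVector σ f k := by
    rw [Fin.sum_univ_succ, Fin.sum_univ_succ (fun k => edgeVector σ f k)]
    simp [add_comm]
  rw [← h2, h, edgeVector]
  linear_combination two_mul_zmod_two (f (Sum.inr (σ 0)))

theorem parallel_add_parallel (σ : Equiv.Perm (Fin (m + 1))) (j k : Fin (m + 1)) :
    parallel σ j k + parallel σ k j = (if j < k then 1 else 0) + (if σ k < σ j then 1 else 0) := by
  rcases lt_trichotomy j k with h | rfl | h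
  · rcases lt_or_gt_of_ne (σ.injective.ne h.ne) with h' | h'
    · simp [parallel, h, h', h.not_gt, h'.not_gt]
    · simp [parallel, h, h', h.not_gt, h'.not_gt, two_mul_zmod_two]
  · simp [parallel]
  · simp [parallel, h, h.not_gt]

/-- Modulo 2 the polar form splits into a bottom-order and a top-order condition, and the two
telescoped sums cancel. -/
theorem isRadical_edgeVector (hf : ∀ p, f (walk σ p) = f p) : IsRadical σ (edgeVector σ f) := by
  intro j
  simp only [parallel_add_parallel, add_mul, ite_mul, one_mul, zero_mul, sum_add_distrib]
  rw [sum_edgeVector_gt hf, sum_edgeVector_lt hf]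
  linear_combination two_mul_zmod_two (f (Sum.inr 0)) + two_mul_zmod_two (f (Sum.inr (σ j)))

end Walk

/-! ### Inversions inside a single cycle of a permutation. -/

section Inversions

variable {α : Type*} [Fintype α] [DecidableEq α]

theorem sign_subtypePerm_sameCycle (π : Equiv.Perm α) (a : α)
    (h : ∀ b, π.SameCycle a (π b) ↔ π.SameCycle a b) :
    Equiv.Perm.sign (π.subtypePerm h) = -(-1) ^ Fintype.card {b // π.SameCycle a b} := by
  have h' : ∀ b, π.SameCycle a (π.cycleOf a b) ↔ π.SameCycle a b := fun b => by
    rw [Equiv.Perm.cycleOf_apply]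
    split_ifs with hb
    · exact h b
    · rfl
  have heq : π.subtypePerm h = (π.cycleOf a).subtypePerm h' := by
    ext ⟨b, hb⟩
    simp [hb.cycleOf_apply]
  rw [heq, Equiv.Perm.sign_subtypePerm]
  -- A fixed point is not an `IsCycle`, but the formula still holds with one element.
  · by_cases ha : π a = a
    · have hcard : Fintype.card {b // π.SameCycle a b} = 1 := by
        rw [Fintype.card_eq_one_iff]
        refine ⟨⟨a, Equiv.Perm.SameCycle.refl _ _⟩, fun ⟨b, hb⟩ => Subtype.ext ?_⟩
        exact ((hb.eq_of_left ha)).symm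
      rw [(Equiv.Perm.cycleOf_eq_one_iff π).2 ha, hcard]
      simp
    · rw [(Equiv.Perm.isCycle_cycleOf π ha).sign, Fintype.card_subtype]
      congr 3
      ext b
      simp [Equiv.Perm.mem_support_cycleOf_iff' ha]
  · intro b hb
    by_contra hab
    exact hb (Equiv.Perm.cycleOf_apply_of_not_sameCycle hab)

/-- The indicator function of the cycle of `a`. -/
def cycleIndicator (π : Equiv.Perm α) (a b : α) : ZMod 2 := if π.SameCycle a b then 1 else 0

theorem cycleIndicator_apply (π : Equiv.Perm α) (a b : α) :
    cycleIndicator π a (π b) = cycleIndicator π a b := by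
  simp [cycleIndicator]

theorem sum_inversions_cycleIndicator {pos : α → ℕ} (hpos : Function.Injective pos)
    (π : Equiv.Perm α) (a : α) :
    ∑ b, ∑ c, (if pos b < pos c ∧ pos (π c) < pos (π b) then
      cycleIndicator π a b * cycleIndicator π a c else 0) = ∑ b, cycleIndicator π a b + 1 := by
  have h : ∀ b, π.SameCycle a (π b) ↔ π.SameCycle a b := fun b =>
    Equiv.Perm.sameCycle_apply_right
  have hsign := sign_subtypePerm_sameCycle π a h
  rw [sign_eq_neg_one_pow_card_inversions
    (pos := fun b : {b // π.SameCycle a b} => pos b.val) fun b c e => Subtype.ext (hpos e)] at hsign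
  have hint := congrArg (fun u : ℤˣ => (u : ℤ)) hsign
  simp only [Units.val_pow_eq_pow_val, Units.val_neg, Units.val_one] at hint
  rw [← signChar_natCast, ← signChar_natCast] at hint
  have hcast : ∀ u v : ZMod 2, signChar u = -signChar v → u = v + 1 := by decide
  have hfin := hcast _ _ hint
  have hs : ∑ b, cycleIndicator π a b = (Fintype.card {b // π.SameCycle a b} : ZMod 2) := by
    simp [cycleIndicator, Fintype.card_subtype]
  rw [hs, ← hfin, card_filter, Nat.cast_sum, Fintype.sum_prod_type]
  have hsub : ∀ g : α → ZMod 2, (∀ b, ¬ π.SameCycle a b → g b = 0) →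
      ∑ b, g b = ∑ b : {b // π.SameCycle a b}, g b := fun g hg => by
    rw [← sum_subtype {b | π.SameCycle a b} (by simp) g, sum_filter]
    refine sum_congr rfl fun b _ => ?_
    split_ifs with hb
    · rfl
    · exact hg b hb
  rw [hsub]
  · refine sum_congr rfl fun b _ => ?_
    rw [hsub]
    · refine sum_congr rfl fun c _ => ?_
      simp only [cycleIndicator, b.2, c.2, if_true, mul_one]
      change _ = ((if pos b < pos c ∧ pos (π c) < pos (π b) then 1 else 0 : ℕ) : ZMod 2)
      split_ifs <;> simp
    · intro c hc
      simp [cycleIndicator, hc]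
  · intro b hb
    simp [cycleIndicator, hb]

/-- `T` is kept as a natural number: the parity of `N(N - 1)/2` depends on `N` modulo 4, so it
cannot be recovered in `ZMod 2`. -/
theorem sum_pairs_cycleIndicator {pos : α → ℕ} (hpos : Function.Injective pos)
    (π : Equiv.Perm α) (a : α) :
    ∃ T : ℕ, ∑ b, ∑ c, (if pos b < pos c then
      cycleIndicator π a b * cycleIndicator π a c else 0) = (T : ZMod 2) ∧
      2 * T + #{b | π.SameCycle a b} = #{b | π.SameCycle a b} * #{b | π.SameCycle a b} := by
  let S : Finset α := {b | π.SameCycle a b}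
  refine ⟨∑ b ∈ S, ∑ c ∈ S, if pos b < pos c then 1 else 0, ?_, ?_⟩
  · push_cast
    simp only [S, sum_filter]
    refine sum_congr rfl fun b _ => ?_
    by_cases hb : π.SameCycle a b
    · simp only [hb, if_true]
      refine sum_congr rfl fun c _ => ?_
      by_cases hc : π.SameCycle a c <;> simp [cycleIndicator, hb, hc]
    · simp [cycleIndicator, hb]
  · change 2 * _ + #S = #S * #S
    have h1 : ∑ b ∈ S, ∑ c ∈ S, (if pos b < pos c then 1 else 0) =
        ∑ b ∈ S, ∑ c ∈ S, (if pos c < pos b then 1 else 0) := sum_comm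
    have h2 : #S = ∑ b ∈ S, ∑ c ∈ S, (if b = c then 1 else 0) := by
      simp
    have h3 : #S * #S = ∑ b ∈ S, ∑ c ∈ S, 1 := by simp
    rw [two_mul, h3]
    nth_rw 2 [h1]
    rw [h2]
    simp only [← sum_add_distrib]
    refine sum_congr rfl fun b _ => sum_congr rfl fun c _ => ?_
    rcases lt_trichotomy (pos b) (pos c) with h | h | h
    · simp [h, h.not_gt, show b ≠ c from fun e => h.ne (congrArg pos e)]
    · simp [hpos h]
    · simp [h, h.not_gt, show b ≠ c from fun e => h.ne' (congrArg pos e)]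

end Inversions

/-! ### The value of the quadratic form on the vector of a cycle. -/

section Arf

variable {m : ℕ} {σ : Equiv.Perm (Fin (m + 1))} {f : Point (m + 1) → ZMod 2}

/-- The position of a point when the top line is read after the bottom line. -/
def position {m : ℕ} : Point (m + 1) → ℕ
  | Sum.inl i => i
  | Sum.inr j => m + 1 + j

theorem position_injective : Function.Injective (position (m := m)) := by
  rintro (i | i) (j | j) h
  · simp only [position] at h
    exact congrArg _ (Fin.ext h)
  · simp only [position] at h
    omega
  · simp only [position] at h
    omega
  · simp only [position] at h
    exact congrArg _ (Fin.ext (by omega))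

theorem position_arc (p : Point (m + 1)) : position (arc (m + 1) p) =
    if p = Sum.inr (Fin.last m) then 0 else position p + 1 := by
  rcases p with i | i <;> rcases Fin.eq_castSucc_or_eq_last i with ⟨j, rfl⟩ | rfl
  · simp [arc_inl_castSucc, position]
  · simp [arc_inl_last, position]
  · simp [arc_inr_castSucc, position, Fin.castSucc_ne_last, add_assoc]
  · simp [arc_inr_last, position]

theorem position_lt_position_last {p : Point (m + 1)} (h : p ≠ Sum.inr (Fin.last m)) :
    position p < position (Sum.inr (Fin.last m)) := by
  rcases p with i | i
  · simp only [position]; omega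
  · have : i ≠ Fin.last m := fun e => h (e ▸ rfl)
    have := Fin.lt_last_iff_ne_last.2 this
    rw [Fin.lt_def, Fin.val_last] at this
    simp only [position, Fin.val_last]
    omega

/-- `arc` is the cyclic shift of positions, so it preserves order except for pairs containing the
last top point, which wraps around to 0. -/
theorem ite_position_arc_lt {p q : Point (m + 1)} (h : p ≠ q) :
    (if position (arc (m + 1) q) < position (arc (m + 1) p) then 1 else 0 : ZMod 2) =
      1 + (if position p < position q then 1 else 0) +
        ((if p = Sum.inr (Fin.last m) then 1 else 0) +
          (if q = Sum.inr (Fin.last m) then 1 else 0)) := by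
  rw [position_arc, position_arc]
  by_cases hp : p = Sum.inr (Fin.last m)
  · have hq : q ≠ Sum.inr (Fin.last m) := fun e => h (hp.trans e.symm)
    have := position_lt_position_last hq
    simp [hp, hq, this.not_gt, two_mul_zmod_two]
  · have hlt := position_lt_position_last hp
    by_cases hq : q = Sum.inr (Fin.last m)
    · simp [hp, hq, hlt, two_mul_zmod_two]
    · rcases lt_or_gt_of_ne (position_injective.ne h) with h' | h'
      · simp [hp, hq, h', h'.not_gt, two_mul_zmod_two]
      · simp [hp, hq, h', h'.not_gt]

/-- Strands exchange the two lines, so only pairs on the same line can be increasing, and these come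
from the non-crossing pairs of edges, once on each line. -/
theorem sum_strand_increasing (hf : ∀ p, f (walk σ p) = f p) :
    ∑ p, ∑ q, (if position p < position q ∧ position (strand σ p) < position (strand σ q) then
      f p * f q else 0) =
      quad σ (edgeVector σ f) + f (Sum.inl 0) + f (Sum.inr 0) := by
  -- Pairing the edge vector with its bottom part alone leaves just the mixed bottom-top products of
  -- `quad`, which therefore sum to zero.
  have hrad := (isRadical_edgeVector hf).sum_parallel fun j => f (Sum.inl j)
  have hlr : ∀ j k : Fin (m + 1), ¬ m + 1 + (j : ℕ) < k := fun j k => by omega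
  have hsymm : ∑ j, ∑ k, (if j < k ∧ σ.symm j < σ.symm k then
      f (Sum.inr j) * f (Sum.inr k) else 0) =
      ∑ j, ∑ k, (if j < k ∧ σ j < σ k then f (Sum.inr (σ j)) * f (Sum.inr (σ k)) else 0) := by
    rw [← Equiv.sum_comp σ]
    refine sum_congr rfl fun j _ => ?_
    rw [← Equiv.sum_comp σ]
    simp only [Equiv.symm_apply_apply, and_comm]
  simp only [Fintype.sum_sum_type]
  simp only [strand, Equiv.coe_fn_mk, position, hlr, false_and, and_false,
    if_false, sum_const_zero, add_zero, zero_add, add_lt_add_iff_left, Fin.val_fin_lt]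
  rw [hsymm, add_assoc, ← sum_edgeVector hf, quad, add_right_comm, two_mul_zmod_two, zero_add]
  refine Eq.trans ?_ ((congrArg₂ (· + ·) rfl hrad).trans (add_zero _))
  simp only [← sum_add_distrib]
  refine sum_congr rfl fun j _ => sum_congr rfl fun k _ => ?_
  simp only [parallel, edgeVector]
  split_ifs
  · linear_combination (-1) * two_mul_zmod_two (f (Sum.inl j) * f (Sum.inl k)) -
      two_mul_zmod_two (f (Sum.inl j) * f (Sum.inr (σ k))) -
      two_mul_zmod_two (f (Sum.inr (σ j)) * f (Sum.inl k))
  · ring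

/-- Only the pairs containing the point `L` whose strand ends at the last top point survive. The
walk sends `L` to `Sum.inl 0`, and the missing pair of `L` with itself accounts for the `+ 1`. -/
theorem sum_pairs_last (hf : ∀ p, f (walk σ p) = f p) :
    ∑ p, ∑ q, (if position p < position q then
      ((if strand σ p = Sum.inr (Fin.last m) then 1 else 0) +
        (if strand σ q = Sum.inr (Fin.last m) then 1 else 0)) * (f p * f q) else 0) =
      f (Sum.inl 0) * (∑ p, f p + 1) := by
  let L := (strand σ).symm (Sum.inr (Fin.last m))
  have hL : ∀ p, strand σ p = Sum.inr (Fin.last m) ↔ p = L := fun p =>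
    (Equiv.eq_symm_apply (strand σ)).symm
  have hfL : f L = f (Sum.inl 0) := by
    rw [← hf L, walk_apply, Equiv.apply_symm_apply, arc_inr_last]
  have h1 : ∑ p, ∑ q, (if position p < position q then
      ((if p = L then 1 else 0) + (if q = L then 1 else 0)) * (f p * f q) else 0) =
      ∑ p, ∑ q, (if p = L then (if position L < position q then f L * f q else 0) else 0) +
      ∑ q, ∑ p, (if q = L then (if position p < position L then f L * f p else 0) else 0) := by
    rw [sum_comm (s := univ) (t := univ) 
      (f := fun q p => if q = L then (if position p < position L then f L * f p else 0) else 0),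
      ← sum_add_distrib]
    refine sum_congr rfl fun p _ => ?_
    rw [← sum_add_distrib]
    refine sum_congr rfl fun q _ => ?_
    by_cases hp : p = L <;> by_cases hq : q = L <;> simp [hp, hq, mul_comm]
  have h2 : ∀ g : Point (m + 1) → ZMod 2,
      ∑ p, ∑ q, (if p = L then g q else 0) = ∑ q, g q := fun g => by
    rw [sum_comm]
    simp
  simp only [hL]
  rw [h1, h2, h2, ← sum_add_distrib, ← hfL, mul_add, mul_sum, mul_one]
  rw [← add_sum_erase _ _ (mem_univ L), ← add_sum_erase univ (fun q => f L * f q) (mem_univ L)]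
  simp only [lt_irrefl, if_false, sq_zmod_two, add_zero, zero_add]
  rw [add_right_comm, two_mul_zmod_two, zero_add]
  refine sum_congr rfl fun q hq => ?_
  rcases lt_or_gt_of_ne (position_injective.ne (ne_of_mem_erase hq)) with h | h
  · simp [h, h.not_gt]
  · simp [h, h.not_gt]

theorem sum_walk_inversions (hf : ∀ p, f (walk σ p) = f p) :
    ∑ p, ∑ q, (if position p < position q ∧ position (walk σ q) < position (walk σ p) then
      f p * f q else 0) =
      ∑ p, ∑ q, (if position p < position q then f p * f q else 0) +
        (quad σ (edgeVector σ f) + f (Sum.inl 0) + f (Sum.inr 0)) +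
        f (Sum.inl 0) * (∑ p, f p + 1) := by
  rw [← sum_strand_increasing hf, ← sum_pairs_last hf, ← sum_add_distrib, ← sum_add_distrib]
  refine sum_congr rfl fun p _ => ?_
  rw [← sum_add_distrib, ← sum_add_distrib]
  refine sum_congr rfl fun q _ => ?_
  by_cases h : position p < position q
  · have hne : strand σ p ≠ strand σ q := fun e => by
      rw [(strand σ).injective e] at h
      exact lt_irrefl _ h
    have key := ite_position_arc_lt hne
    rw [← walk_apply, ← walk_apply] at key
    simp only [h, true_and, if_true]
    have hite : ∀ (P : Prop) [Decidable P], (if P then f p * f q else 0) =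
        (if P then 1 else 0) * (f p * f q) := fun P _ => by split_ifs <;> simp
    rw [hite (position (walk σ q) < position (walk σ p)), key,
      hite (position (strand σ p) < position (strand σ q))]
    ring
  · simp [h]

/-- Invariance replaces the bottom values by the values at the `arc`-successors of the top points.
Each top arc is thus counted twice, and each mark once. -/
theorem sum_invariant (g : Point (m + 1) → ℕ) (hg : ∀ p, g (walk σ p) = g p) :
    ∑ p, g p = 2 * ∑ i : Fin m, g (Sum.inr i.succ) + g (Sum.inl 0) + g (Sum.inr 0) := by
  have h : ∑ j, g (Sum.inl j) = ∑ j, g (arc (m + 1) (Sum.inr j)) := by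
    rw [← Equiv.sum_comp σ fun j => g (arc (m + 1) (Sum.inr j))]
    refine sum_congr rfl fun j _ => ?_
    rw [← hg (Sum.inl j)]
    rfl
  rw [Fintype.sum_sum_type, h, Fin.sum_univ_castSucc, Fin.sum_univ_succ fun j => g (Sum.inr j)]
  simp only [arc_inr_castSucc, arc_inr_last]
  ring

/-- The quadratic form takes the value `ℓ + 1` on the vector of a cycle of length `ℓ`. -/
theorem quad_edgeVector_cycleIndicator (σ : Equiv.Perm (Fin (m + 1))) (p : Point (m + 1)) :
    quad σ (edgeVector σ (cycleIndicator (walk σ) p)) =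
      (cycleLength σ (Quotient.mk (Equiv.Perm.SameCycle.setoid (walk σ)) p) : ZMod 2) + 1 := by
  let g : Point (m + 1) → ℕ := fun q => if (walk σ).SameCycle p q then 1 else 0
  have hg : ∀ q, g (walk σ q) = g q := fun q => by simp [g]
  have hgf : ∀ q, cycleIndicator (walk σ) p q = g q := fun q => by simp [cycleIndicator, g]
  have hlen : cycleLength σ (Quotient.mk (Equiv.Perm.SameCycle.setoid (walk σ)) p) =
      ∑ i : Fin m, g (Sum.inr i.succ) := by
    rw [cycleLength, card_filter, Fin.sum_univ_succ]
    simp only [Fin.val_zero, lt_irrefl, false_and, if_false, zero_add]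
    refine sum_congr rfl fun i _ => ?_
    simp only [g, Fin.val_succ, Nat.succ_pos, true_and]
    refine if_congr ?_ rfl rfl
    rw [Quotient.eq]
    exact Equiv.Perm.sameCycle_comm
  have hcard : #{q | (walk σ).SameCycle p q} = ∑ q, g q := by rw [card_filter]
  obtain ⟨T, hT, hT2⟩ := sum_pairs_cycleIndicator position_injective (walk σ) p
  have hinv := sum_inversions_cycleIndicator position_injective (walk σ) p
  rw [sum_walk_inversions (cycleIndicator_apply _ _), hT] at hinv
  rw [hcard, sum_invariant g hg, ← hlen] at hT2
  have hs : ∑ q, cycleIndicator (walk σ) p q = ((∑ q, g q : ℕ) : ZMod 2) := by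
    push_cast
    exact sum_congr rfl fun q _ => hgf q
  rw [hs, sum_invariant g hg, ← hlen, hgf, hgf] at hinv
  generalize cycleLength σ _ = l at *
  generalize quad σ _ = Q at *
  have h01 : ∀ q, g q = 0 ∨ g q = 1 := fun q => by
    by_cases h : (walk σ).SameCycle p q <;> simp [g, h]
  have two : (2 : ZMod 2) = 0 := rfl
  -- The cycle has `2 * l + a + b` points, where `a` and `b` record whether it passes through the
  -- two marks; this determines the parity of `T`.
  rcases h01 (Sum.inl 0) with ha | ha <;> rcases h01 (Sum.inr 0) with hb | hb <;>
    rw [ha, hb] at hT2 hinv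
  · have hc := congrArg (Nat.cast : ℕ → ZMod 2) (show T + l = 2 * l ^ 2 by nlinarith)
    push_cast at hc hinv
    linear_combination hinv - hc + (l - l ^ 2) * two
  · have hc := congrArg (Nat.cast : ℕ → ZMod 2) (show T = 2 * l ^ 2 + l by nlinarith)
    push_cast at hc hinv
    linear_combination hinv - hc + (-l ^ 2) * two
  · have hc := congrArg (Nat.cast : ℕ → ZMod 2) (show T = 2 * l ^ 2 + l by nlinarith)
    push_cast at hc hinv
    linear_combination hinv - hc + (-l - 1 - l ^ 2) * two
  · have hc := congrArg (Nat.cast : ℕ → ZMod 2) (show T + l + 1 = 2 * (l + 1) ^ 2 by nlinarith)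
    push_cast at hc hinv
    linear_combination hinv - hc + (-1 - (l + 1) ^ 2) * two

end Arf

/-! ### Deletion of an edge and the number of cycles. -/

theorem rel_of_sameCycle {α : Type*} [Finite α] {π : Equiv.Perm α} {r : α → α → Prop}
    (hr : Equivalence r) (h : ∀ a, r a (π a)) {a b : α} (hab : π.SameCycle a b) : r a b := by
  obtain ⟨k, rfl⟩ := hab.exists_nat_pow_eq
  induction k with
  | zero => exact hr.refl a
  | succ k ih =>
    rw [pow_succ', Equiv.Perm.mul_apply]
    exact hr.trans (ih ⟨k, by simp⟩) (h _)

section Line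

variable {m : ℕ} {P : Type*} {r : P → P → Prop} {A : P → P}
  {s t : Fin (m + 2) → P} {i : Fin (m + 2)}

/-- The successor changes only when the deleted point is skipped, and then the old and new
successors are `s i` and `A (s i)`. -/
theorem rel_succAbove_succ (hr : Equivalence r)
    (hs : ∀ j : Fin (m + 1), A (s j.castSucc) = s j.succ) (hi : r (A (s i)) (s i)) (j : Fin m) :
    r (A (s (i.succAbove j.castSucc))) (s (i.succAbove j.succ)) := by
  by_cases h : j.castSucc.castSucc < i
  · rw [Fin.succAbove_of_castSucc_lt _ _ h, hs]
    by_cases h' : j.succ.castSucc < i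
    · rw [Fin.succAbove_of_castSucc_lt _ _ h', Fin.succ_castSucc]
      exact hr.refl _
    · have e : i = j.succ.castSucc := by
        simp only [Fin.lt_def, Fin.val_castSucc, Fin.val_succ] at h h'
        ext
        simp only [Fin.val_castSucc, Fin.val_succ]
        omega
      rw [Fin.succAbove_of_le_castSucc _ _ (not_lt.1 h'), Fin.succ_castSucc, ← hs, ← e]
      exact hr.symm hi
  · have h' : i ≤ j.succ.castSucc := (not_lt.1 h).trans (by simp [Fin.le_def])
    rw [Fin.succAbove_of_le_castSucc _ _ (not_lt.1 h), Fin.succAbove_of_le_castSucc _ _ h',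
      Fin.succ_castSucc, hs]
    exact hr.refl _

theorem rel_succAbove_last (hr : Equivalence r)
    (hs : ∀ j : Fin (m + 1), A (s j.castSucc) = s j.succ) (hl : A (s (Fin.last (m + 1))) = t 0)
    (hi : r (A (s i)) (s i)) : r (A (s (i.succAbove (Fin.last m)))) (t 0) := by
  by_cases h : i = Fin.last (m + 1)
  · subst h
    rw [Fin.succAbove_last, hs, Fin.succ_last, ← hl]
    exact hr.symm hi
  · rw [Fin.succAbove_ne_last_last h, hl]
    exact hr.refl _

theorem rel_succAbove_zero (hr : Equivalence r)
    (hs : ∀ j : Fin (m + 1), A (s j.castSucc) = s j.succ) (hi : r (A (s i)) (s i)) :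
    r (s 0) (s (i.succAbove 0)) := by
  by_cases h : i = 0
  · subst h
    rw [Fin.succAbove_zero, ← hs]
    exact hr.symm hi
  · rw [Fin.succAbove_ne_zero_zero h]
    exact hr.refl _

end Line

/-- The inclusion of the points of the reduction into the points of the diagram. -/
def includePoint {n : ℕ} (σ : Equiv.Perm (Fin (n + 1))) (i : Fin (n + 1)) :
    Point n → Point (n + 1) := Sum.map i.succAbove (σ i).succAbove

theorem includePoint_strand {n : ℕ} (σ : Equiv.Perm (Fin (n + 1))) (i : Fin (n + 1)) (p : Point n) :
    includePoint σ i (strand (reduction σ i) p) = strand σ (includePoint σ i p) := by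
  rcases p with j | j
  · simp [includePoint, strand, succAbove_reduction]
  · simp only [includePoint, strand, Equiv.coe_fn_mk, Sum.map_inl, Sum.map_inr]
    congr 1
    rw [Equiv.eq_symm_apply, ← succAbove_reduction, Equiv.apply_symm_apply]

section Reduction

variable {m : ℕ} {σ : Equiv.Perm (Fin (m + 2))} {i : Fin (m + 2)}

theorem sameCycle_arc_inl (h : (walk σ).SameCycle (Sum.inl i) (Sum.inr (σ i))) :
    (walk σ).SameCycle (arc (m + 2) (Sum.inl i)) (Sum.inl i) := by
  have h1 : walk σ (Sum.inr (σ i)) = arc (m + 2) (Sum.inl i) := by simp [walk_apply, strand]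
  rw [← h1, Equiv.Perm.sameCycle_apply_left]
  exact h.symm

theorem sameCycle_arc_inr (h : (walk σ).SameCycle (Sum.inl i) (Sum.inr (σ i))) :
    (walk σ).SameCycle (arc (m + 2) (Sum.inr (σ i))) (Sum.inr (σ i)) := by
  have h1 : walk σ (Sum.inl i) = arc (m + 2) (Sum.inr (σ i)) := rfl
  rwa [← h1, Equiv.Perm.sameCycle_apply_left]

/-- When both ends of the deleted edge share a cycle, each end also shares it with its
`arc`-successor, so skipping the end does not change the cycle. -/
theorem sameCycle_includePoint_arc (h : (walk σ).SameCycle (Sum.inl i) (Sum.inr (σ i)))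
    (p : Point (m + 1)) : (walk σ).SameCycle (arc (m + 2) (includePoint σ i p))
      (includePoint σ i (arc (m + 1) p)) := by
  have hr := Equiv.Perm.SameCycle.equivalence (walk σ)
  rcases p with j | j <;> rcases Fin.eq_castSucc_or_eq_last j with ⟨k, rfl⟩ | rfl
  · rw [arc_inl_castSucc]
    exact rel_succAbove_succ (s := Sum.inl) hr arc_inl_castSucc (sameCycle_arc_inl h) k
  · rw [arc_inl_last]
    exact hr.trans (rel_succAbove_last (s := Sum.inl) (t := Sum.inr) hr arc_inl_castSucc
      arc_inl_last (sameCycle_arc_inl h))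
      (rel_succAbove_zero (s := Sum.inr) hr arc_inr_castSucc (sameCycle_arc_inr h))
  · rw [arc_inr_castSucc]
    exact rel_succAbove_succ (s := Sum.inr) hr arc_inr_castSucc (sameCycle_arc_inr h) k
  · rw [arc_inr_last]
    exact hr.trans (rel_succAbove_last (s := Sum.inr) (t := Sum.inl) hr arc_inr_castSucc
      arc_inr_last (sameCycle_arc_inr h))
      (rel_succAbove_zero (s := Sum.inl) hr arc_inl_castSucc (sameCycle_arc_inl h))

theorem sameCycle_includePoint (h : (walk σ).SameCycle (Sum.inl i) (Sum.inr (σ i)))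
    {p q : Point (m + 1)} (hpq : (walk (reduction σ i)).SameCycle p q) :
    (walk σ).SameCycle (includePoint σ i p) (includePoint σ i q) := by
  have hr := Equiv.Perm.SameCycle.equivalence (walk σ)
  refine rel_of_sameCycle (r := fun p q => (walk σ).SameCycle (includePoint σ i p)
    (includePoint σ i q)) ⟨fun _ => hr.refl _, hr.symm, hr.trans⟩ (fun p => ?_) hpq
  have h1 := sameCycle_includePoint_arc h (strand (reduction σ i) p)
  rw [includePoint_strand] at h1
  exact Equiv.Perm.sameCycle_apply_left.1 h1

/-- This gives surjectivity on cycles: the cycle of the deleted ends still contains a surviving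
point, found just after `Sum.inl i`. -/
theorem exists_sameCycle_includePoint (h : (walk σ).SameCycle (Sum.inl i) (Sum.inr (σ i)))
    (q : Point (m + 2)) : ∃ p, (walk σ).SameCycle (includePoint σ i p) q := by
  have hr := Equiv.Perm.SameCycle.equivalence (walk σ)
  have hi : ∃ p, (walk σ).SameCycle (includePoint σ i p) (Sum.inl i) := by
    rcases Fin.eq_castSucc_or_eq_last i with ⟨k, hk⟩ | hk
    · have hne : k.succ ≠ i := hk ▸ Fin.castSucc_lt_succ.ne'
      obtain ⟨j, hj⟩ := Fin.exists_succAbove_eq hne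
      refine ⟨Sum.inl j, ?_⟩
      have := sameCycle_arc_inl h
      nth_rw 1 [hk] at this
      rw [arc_inl_castSucc, ← hj] at this
      exact this
    · refine ⟨Sum.inr 0, hr.trans (hr.symm (rel_succAbove_zero (s := Sum.inr) hr
        arc_inr_castSucc (sameCycle_arc_inr h))) ?_⟩
      have := sameCycle_arc_inl h
      nth_rw 1 [hk] at this
      rwa [arc_inl_last] at this
  rcases q with j | j
  · by_cases hj : j = i
    · rwa [hj]
    · obtain ⟨k, rfl⟩ := Fin.exists_succAbove_eq hj
      exact ⟨Sum.inl k, hr.refl _⟩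
  · by_cases hj : j = σ i
    · obtain ⟨p, hp⟩ := hi
      exact ⟨p, hj ▸ hr.trans hp h⟩
    · obtain ⟨k, rfl⟩ := Fin.exists_succAbove_eq hj
      exact ⟨Sum.inr k, hr.refl _⟩

/-- Deleting an edge whose two strands lie on the same cycle does not lower the number of
cycles. -/
theorem card_cycle_le_card_cycle_reduction
    (h : (walk σ).SameCycle (Sum.inl i) (Sum.inr (σ i))) :
    Fintype.card (Cycle σ) ≤ Fintype.card (Cycle (reduction σ i)) := by
  refine Fintype.card_le_of_surjective
    (Quotient.map (includePoint σ i) fun _ _ => sameCycle_includePoint h) fun c => ?_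
  induction c using Quotient.inductionOn with
  | h q =>
    obtain ⟨p, hp⟩ := exists_sameCycle_includePoint h q
    exact ⟨Quotient.mk _ p, Quotient.sound hp⟩

end Reduction

/-! ### Effect of cycle lengths on the sign. -/

theorem card_cycleInvariant {n : ℕ} (σ : Equiv.Perm (Fin n)) :
    Multiset.card (cycleInvariant σ) = Fintype.card (Cycle σ) := by
  simp [cycleInvariant]

theorem exists_point_of_mem_cycleInvariant {n : ℕ} {σ : Equiv.Perm (Fin n)} {k : ℕ}
    (hk : k ∈ cycleInvariant σ) :
    ∃ p, cycleLength σ (Quotient.mk (Equiv.Perm.SameCycle.setoid (walk σ)) p) = k := by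
  obtain ⟨c, -, hc⟩ := Multiset.mem_map.1 hk
  induction c using Quotient.inductionOn with
  | h p => exact ⟨p, hc⟩

theorem cycleLength_mem_cycleInvariant {n : ℕ} (σ : Equiv.Perm (Fin n)) (c : Cycle σ) :
    cycleLength σ c ∈ cycleInvariant σ :=
  Multiset.mem_map_of_mem _ (mem_univ c)

/-- The sign vanishes as soon as there is a cycle of even length. -/
theorem sign_eq_zero_of_even {n : ℕ} {σ : Equiv.Perm (Fin n)} {k : ℕ}
    (hk : k ∈ cycleInvariant σ) (hev : Even k) : sign σ = 0 := by
  obtain ⟨p, rfl⟩ := exists_point_of_mem_cycleInvariant hk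
  rcases n with _ | m
  · rcases p with p | p <;> exact p.elim0
  · have hq := quad_edgeVector_cycleIndicator σ p
    rw [(ZMod.natCast_eq_zero_iff_even).2 hev, zero_add] at hq
    rw [sign, arf_eq_zero_of_isRadical (isRadical_edgeVector (cycleIndicator_apply _ p)) hq,
      Int.sign_zero]

/-- Deleting an edge whose strands lie on different cycles keeps the sign if the cycle through the
left end of the lower endpoint of the edge has odd length. -/
theorem sign_reduction_of_odd {n : ℕ} {σ : Equiv.Perm (Fin (n + 1))} {i : Fin (n + 1)}
    (h : ¬ (walk σ).SameCycle (Sum.inl i) (Sum.inr (σ i)))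
    (hodd : Odd (cycleLength σ (Quotient.mk (Equiv.Perm.SameCycle.setoid (walk σ)) (Sum.inl i)))) :
    sign (reduction σ i) = sign σ := by
  have hq := quad_edgeVector_cycleIndicator σ (Sum.inl i)
  rw [(ZMod.natCast_eq_one_iff_odd).2 hodd, two_mul_zmod_two] at hq
  have hi : edgeVector σ (cycleIndicator (walk σ) (Sum.inl i)) i = 1 := by
    simp [edgeVector, cycleIndicator, h, Equiv.Perm.SameCycle.refl]
  rw [sign, sign, arf_eq_two_mul_of_isRadical
    (isRadical_edgeVector (cycleIndicator_apply _ _)) hq hi, Int.sign_mul]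
  rw [show Int.sign 2 = 1 from rfl, one_mul]

end PermDiagram

open PermDiagram in
theorem mainTheorem5 (n : ℕ) (σ : Equiv.Perm (Fin (n + 1))) (i : Fin (n + 1)) (ℓ ℓ' : ℕ)
    (hℓ : ({ℓ, ℓ'} : Multiset ℕ) ≤ PermDiagram.cycleInvariant σ)
    (hred : PermDiagram.cycleInvariant (PermDiagram.reduction σ i) =
      PermDiagram.cycleInvariant σ - {ℓ, ℓ'} + {ℓ + ℓ' - 1}) :
    ((∃ k ∈ PermDiagram.cycleInvariant (PermDiagram.reduction σ i), Even k) →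
      PermDiagram.sign (PermDiagram.reduction σ i) = 0) ∧
    ((∀ k ∈ PermDiagram.cycleInvariant (PermDiagram.reduction σ i), ¬ Even k) →
      ¬ (PermDiagram.sign σ = 0 ∧ Even ℓ ∧ Even ℓ') →
      PermDiagram.sign (PermDiagram.reduction σ i) = PermDiagram.sign σ) := by
  refine ⟨fun ⟨k, hk, hev⟩ => sign_eq_zero_of_even hk hev, fun hodd hexc => ?_⟩
  have hmem : ℓ + ℓ' - 1 ∈ cycleInvariant (reduction σ i) := by simp [hred]
  have hsum := hodd _ hmem
  have hℓmem : ℓ ∈ cycleInvariant σ := Multiset.mem_of_le hℓ (by simp)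
  have hℓodd : ¬ Even ℓ ∧ ¬ Even ℓ' := by
    by_contra hcon
    -- Oddness of `ℓ + ℓ' - 1` forces equal parity; the truncated case `ℓ = ℓ' = 0` gives the even
    -- value 0 and is excluded.
    have hboth : Even ℓ ∧ Even ℓ' := by
      simp only [Nat.even_iff] at *
      omega
    exact hexc ⟨sign_eq_zero_of_even hℓmem hboth.1, hboth⟩
  have hall : ∀ k ∈ cycleInvariant σ, Odd k := by
    intro k hk
    rw [← Nat.not_even_iff_odd]
    rw [← tsub_add_cancel_of_le hℓ, Multiset.mem_add] at hk
    rcases hk with hk | hk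
    · exact hodd k (by rw [hred]; exact Multiset.mem_add.2 (Or.inl hk))
    · simp only [Multiset.insert_eq_cons, Multiset.mem_cons, Multiset.mem_singleton] at hk
      rcases hk with rfl | rfl
      exacts [hℓodd.1, hℓodd.2]
  -- As all cycles are odd, there is no need to know which of them have lengths `ℓ` and `ℓ'`; it
  -- remains to separate the ends of the edge.
  refine sign_reduction_of_odd (fun hsame => ?_) (hall _ (cycleLength_mem_cycleInvariant σ _))
  have hcard := congrArg Multiset.card hred
  have hle := Multiset.card_le_card hℓ
  rw [Multiset.card_add, Multiset.card_sub hℓ] at hcard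
  simp only [Multiset.insert_eq_cons, Multiset.card_cons, Multiset.card_singleton,
    card_cycleInvariant] at hcard hle
  rcases n with _ | m
  -- For `n = 0` the reduction has no points, hence no cycles, yet `λ'` would be nonempty.
  · obtain ⟨p, -⟩ := exists_point_of_mem_cycleInvariant hmem
    rcases p with p | p <;> exact p.elim0
  · have := card_cycle_le_card_cycle_reduction hsame
    omega
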